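/- **Definitions.** Let $G$ be a group and write $[A,B]$ for the subgroup generated by the commutators of elements of $A$ and $B$, and $[A_1,\dots,A_{m+1}]=[[A_1,\dots,A_m],A_{m+1}]$ with $[A_1]=A_1$. For a commutative monoid $M$ and a function $\phi$ from $M$ to the subgroups of $G$, put $\phi_s^+=\langle \phi_{s+t} : t\in M\setminus\{0\}\rangle$. The *length* of $\phi$ is the number of $s\in M\setminus\{0\}$ with $\phi_s\neq\phi_s^+$. The function $\phi$ is a *filter* if $\phi_0=G$ and $[\phi_s,\phi_t]\le\phi_{s+t}\le\phi_s\cap\phi_t$ for all $s,t\in M$; then $L_s=\phi_s/\phi_s^+$ is abelian for $s\ne 0$, and commutation induces biadditive maps $[\,,]:L_s\times L_t\to L_{s+t}$ for $s,t\neq 0$. For a prime $p$, the *$\eta$ series* (exponent-$p$ central series) of $G$ is the filter on $\mathbb N=\{0,1,2,\dots\}$ given by $\eta_0=\eta_1=G$ and $\eta_{i+1}=[G,\eta_i]\,\eta_i^p$ for $i\ge 1$, where $\eta_i^p$ is generated by the $p$-th powers of the elements of $\eta_i$. Let $\phi$ be a filter on $\mathbb N$ and let $s$ be the least nonzero index with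 $L_s\ne 0$. The adjoint ring of $[\,,]:L_s\times L_s\to L_{2s}$ is $$A=\{(X,Y)\in \mathrm{End}(L_s)\times\mathrm{End}(L_s)^{\mathrm{op}} : [uX,v]=[u,Yv]\text{ for all }u,v\in L_s\},$$ where $X$ acts on the right and $Y$ on the left. Let $J$ be its Jacobson radical, $J^0=A$, $J^{i+1}=J^iJ$, and let $H_i$ be the subgroup with $\phi_s^+\le H_i\le\phi_s$ and $H_i/\phi_s^+=L_sJ^i$. Let $\mathtt X$ be the set of pairs $(u,i)\in\mathbb N^2$ with $u\le s$ (equivalently, those preceding $(s+1,0)$ lexicographically), and for $(u,i)\in\mathtt X$ put $\alpha_{(u,i)}=H_i$ if $u=s$ and $\alpha_{(u,i)}=\phi_u$ otherwise. The *lex-least adjoint refinement* of $\phi$ is the function $\bar\alpha$ on $\mathbb N^2$ whose value $\bar\alpha_x$ is the subgroup generated by all $[\alpha_{x_1},\dots,\alpha_{x_d}]$ with $d\ge1$, $x_1,\dots,x_d\in\mathtt X$ and $x_1+\dots+x_d=x$. **Theorem.** There is a constant $c>0$ such that for every prime $p$ and all sufficiently large $n$ (depending on $p$) there are at least $$p^{\,2n^3/729+c\,n^2}$$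 pairwise nonisomorphic groups of order $p^n$ whose $\eta$ series has length $2$ and whose lex-least adjoint refinement of the $\eta$ series has length at least $6$. -/

import Mathlib

/-! ### Filters on groups -/

/-- A filter on a group `G` over a commutative monoid `M`: subgroups `φ s` with `φ 0 = G` and
`[φ s, φ t] ≤ φ (s + t) ≤ φ s ∩ φ t`. -/
structure GroupFilter (G M : Type*) [Group G] [AddCommMonoid M] where
  toFun : M → Subgroup G
  map_zero : toFun 0 = ⊤
  commutator_le : ∀ s t, ⁅toFun s, toFun t⁆ ≤ toFun (s + t)
  map_add_le : ∀ s t, toFun (s + t) ≤ toFun s ⊓ toFun t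

/-- `φ_s⁺ = ∏_{t ≠ 0} φ_{s + t}`. -/
def seriesBoundary {G M : Type*} [Group G] [AddCommMonoid M] (φ : M → Subgroup G) (s : M) :
    Subgroup G :=
  ⨆ (t : M) (_ : t ≠ 0), φ (s + t)

/-- The length of a series `φ : M → 2^G`: the number of `s ≠ 0` for which the factor
`L_s = φ_s / φ_s⁺` is nontrivial. -/
noncomputable def seriesLength {G M : Type*} [Group G] [AddCommMonoid M] (φ : M → Subgroup G) :
    ℕ∞ :=
  Set.encard {s : M | s ≠ 0 ∧ seriesBoundary φ s ≠ φ s}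

namespace GroupFilter

open scoped commutatorElement

variable {G M : Type*} [Group G] [AddCommMonoid M]

instance : CoeFun (GroupFilter G M) (fun _ => M → Subgroup G) := ⟨GroupFilter.toFun⟩

/-- The subgroup `φ_s⁺`. -/
def boundary (φ : GroupFilter G M) (s : M) : Subgroup G := seriesBoundary φ s

theorem normal (φ : GroupFilter G M) (s : M) : (φ s).Normal := by
  rw [← Subgroup.commutator_top_left_le_iff, ← φ.map_zero]
  simpa using φ.commutator_le 0 s

instance boundary_normal (φ : GroupFilter G M) (s : M) : (φ.boundary s).Normal := by
  unfold boundary seriesBoundary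
  have := φ.normal
  infer_instance

theorem le_boundary (φ : GroupFilter G M) (s : M) {t : M} (ht : t ≠ 0) :
    φ (s + t) ≤ φ.boundary s :=
  le_iSup₂_of_le (f := fun (t : M) (_ : t ≠ 0) => φ (s + t)) t ht le_rfl

/-- `[φ_s⁺, φ_t] ≤ φ_{s+t}⁺`. -/
theorem commutator_boundary_left (φ : GroupFilter G M) (s t : M) :
    ⁅φ.boundary s, φ t⁆ ≤ φ.boundary (s + t) := by
  rw [Subgroup.commutator_comm, Subgroup.commutator_le]
  intro y hy x hx
  have key : φ.boundary s ≤ (Subgroup.centralizer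
      (((φ t).map (QuotientGroup.mk' (φ.boundary (s + t)))) : Set _)).comap
      (QuotientGroup.mk' (φ.boundary (s + t))) := by
    refine iSup₂_le fun r hr z hz => ?_
    rw [Subgroup.mem_comap, Subgroup.mem_centralizer_iff_commutator_eq_one]
    rintro _ ⟨w, hw, rfl⟩
    rw [← map_commutatorElement]
    refine (QuotientGroup.eq_one_iff _).2 (φ.le_boundary (s + t) hr ?_)
    have := φ.commutator_le t (s + r) (Subgroup.commutator_mem_commutator hw hz)
    rwa [show s + t + r = t + (s + r) by abel]
  have h1 := key hx
  rw [Subgroup.mem_comap, Subgroup.mem_centralizer_iff_commutator_eq_one] at h1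
  have h2 := h1 _ ⟨y, hy, rfl⟩
  rw [← map_commutatorElement] at h2
  exact (QuotientGroup.eq_one_iff _).1 h2

/-- The homogeneous component `L_s = φ_s / φ_s⁺`, written additively (used for `s ≠ 0`). -/
def Component (φ : GroupFilter G M) (s : M) : Type _ :=
  Additive (φ s ⧸ (φ.boundary s).subgroupOf (φ s))

instance (φ : GroupFilter G M) (s : M) : AddGroup (φ.Component s) :=
  inferInstanceAs (AddGroup (Additive (φ s ⧸ (φ.boundary s).subgroupOf (φ s))))

/-- The class in `L_s` of an element of `φ_s`. -/
def toComponent (φ : GroupFilter G M) (s : M) (x : φ s) : φ.Component s :=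
  Additive.ofMul (QuotientGroup.mk x)

theorem toComponent_surjective (φ : GroupFilter G M) (s : M) :
    Function.Surjective (φ.toComponent s) :=
  fun u => (QuotientGroup.mk_surjective (s := (φ.boundary s).subgroupOf (φ s)) u.toMul)

theorem toComponent_mul (φ : GroupFilter G M) (s : M) (x y : φ s) :
    φ.toComponent s (x * y) = φ.toComponent s x + φ.toComponent s y := rfl

theorem toComponent_eq_iff (φ : GroupFilter G M) (s : M) (x y : φ s) :
    φ.toComponent s x = φ.toComponent s y ↔ (x : G)⁻¹ * y ∈ φ.boundary s := by
  refine Iff.trans (Iff.trans Additive.ofMul.injective.eq_iff QuotientGroup.eq) ?_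
  rfl

instance (φ : GroupFilter G M) (s : M) [NeZero s] : AddCommGroup (φ.Component s) :=
  { (inferInstance : AddGroup (φ.Component s)) with
    add_comm := by
      intro u v
      obtain ⟨x, rfl⟩ := φ.toComponent_surjective s u
      obtain ⟨y, rfl⟩ := φ.toComponent_surjective s v
      rw [← toComponent_mul, ← toComponent_mul, toComponent_eq_iff]
      have h := φ.le_boundary s (NeZero.ne s) (φ.commutator_le s s
        (Subgroup.commutator_mem_commutator ((φ s).inv_mem y.2) ((φ s).inv_mem x.2)))
      simpa [commutatorElement_def, mul_assoc] using h }

/-- Modulo `φ_{s+t}⁺`, elements of `φ_s⁺` commute with elements of `φ_t`. -/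
theorem commute_boundary (φ : GroupFilter G M) (s t : M) {x y : G} (hx : x ∈ φ.boundary s)
    (hy : y ∈ φ t) : Commute (x : G ⧸ φ.boundary (s + t)) (y : G ⧸ φ.boundary (s + t)) := by
  rw [← commutatorElement_eq_one_iff_commute]
  exact (QuotientGroup.eq_one_iff _).2 (φ.commutator_boundary_left s t
    (Subgroup.commutator_mem_commutator hx hy))

/-- The commutation bimap `L_s × L_t → L_{s+t}`, sending the classes of `x` and `y` to the class of
`[x, y]`. (By biadditivity the conventions `x⁻¹ y⁻¹ x y` and `x y x⁻¹ y⁻¹` for `[x, y]` give the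
same map.) -/
def bracket (φ : GroupFilter G M) (s t : M) (u : φ.Component s) (v : φ.Component t) :
    φ.Component (s + t) :=
  Quotient.liftOn₂ u.toMul v.toMul
    (fun x y => φ.toComponent (s + t) ⟨⁅(x : G), (y : G)⁆,
      φ.commutator_le s t (Subgroup.commutator_mem_commutator x.2 y.2)⟩)
    (by
      intro x y x' y' hx hy
      have hx := QuotientGroup.leftRel_apply.1 hx
      have hy := QuotientGroup.leftRel_apply.1 hy
      rw [Subgroup.mem_subgroupOf] at hx hy
      rw [toComponent_eq_iff, ← QuotientGroup.eq]
      have hA := φ.commute_boundary s t hx y'.2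
      have hB := φ.commute_boundary t s hy x.2
      rw [add_comm t s] at hB
      simp only [commutatorElement_def, QuotientGroup.mk_mul, QuotientGroup.mk_inv,
        Subgroup.coe_mul, Subgroup.coe_inv] at hA hB ⊢
      generalize ((x : G) : G ⧸ φ.boundary (s + t)) = X at *
      generalize ((y : G) : G ⧸ φ.boundary (s + t)) = Y at *
      generalize ((x' : G) : G ⧸ φ.boundary (s + t)) = X' at *
      generalize ((y' : G) : G ⧸ φ.boundary (s + t)) = Y' at *
      obtain ⟨A, rfl⟩ : ∃ A, X' = X * A := ⟨X⁻¹ * X', by group⟩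
      obtain ⟨B, rfl⟩ : ∃ B, Y' = Y * B := ⟨Y⁻¹ * Y', by group⟩
      simp only [inv_mul_cancel_left] at hA hB
      calc X * Y * X⁻¹ * Y⁻¹ = X * Y * (X⁻¹ * B) * B⁻¹ * Y⁻¹ := by group
        _ = X * Y * (B * X⁻¹) * B⁻¹ * Y⁻¹ := by rw [(hB.inv_right).eq]
        _ = X * (Y * B * A) * A⁻¹ * X⁻¹ * (B⁻¹ * Y⁻¹) := by group
        _ = X * (A * (Y * B)) * A⁻¹ * X⁻¹ * (B⁻¹ * Y⁻¹) := by rw [hA.eq]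
        _ = X * A * (Y * B) * (X * A)⁻¹ * (Y * B)⁻¹ := by group)

theorem bracket_toComponent (φ : GroupFilter G M) (s t : M) (x : φ s) (y : φ t) :
    φ.bracket s t (φ.toComponent s x) (φ.toComponent t y) =
      φ.toComponent (s + t) ⟨⁅(x : G), (y : G)⁆,
        φ.commutator_le s t (Subgroup.commutator_mem_commutator x.2 y.2)⟩ := rfl

theorem bracket_add_left (φ : GroupFilter G M) (s t : M) [NeZero s] (u u' : φ.Component s)
    (v : φ.Component t) :
    φ.bracket s t (u + u') v = φ.bracket s t u v + φ.bracket s t u' v := by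
  obtain ⟨x, rfl⟩ := φ.toComponent_surjective s u
  obtain ⟨x', rfl⟩ := φ.toComponent_surjective s u'
  obtain ⟨y, rfl⟩ := φ.toComponent_surjective t v
  rw [add_comm (φ.toComponent s x), ← toComponent_mul]
  simp only [bracket_toComponent]
  rw [← toComponent_mul, toComponent_eq_iff, ← QuotientGroup.eq]
  have h2 := φ.commutator_le s t (Subgroup.commutator_mem_commutator x.2 y.2)
  have h1 : (x' : G) ∈ φ s := x'.2
  have h : Commute ((x' : G) : G ⧸ φ.boundary (s + t))
      ((⁅(x : G), (y : G)⁆ : G) : G ⧸ φ.boundary (s + t)) := by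
    rw [← commutatorElement_eq_one_iff_commute]
    refine (QuotientGroup.eq_one_iff _).2 (φ.le_boundary (s + t) (NeZero.ne s) ?_)
    rw [add_comm (s + t) s]
    exact φ.commutator_le s (s + t) (Subgroup.commutator_mem_commutator h1 h2)
  simp only [commutatorElement_def, QuotientGroup.mk_mul, QuotientGroup.mk_inv,
    Subgroup.coe_mul] at h ⊢
  generalize ((x : G) : G ⧸ φ.boundary (s + t)) = X at *
  generalize ((y : G) : G ⧸ φ.boundary (s + t)) = Y at *
  generalize ((x' : G) : G ⧸ φ.boundary (s + t)) = X' at *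
  calc X' * X * Y * (X' * X)⁻¹ * Y⁻¹ = (X' * (X * Y * X⁻¹ * Y⁻¹)) * (Y * X'⁻¹ * Y⁻¹) := by group
    _ = ((X * Y * X⁻¹ * Y⁻¹) * X') * (Y * X'⁻¹ * Y⁻¹) := by rw [h.eq]
    _ = X * Y * X⁻¹ * Y⁻¹ * (X' * Y * X'⁻¹ * Y⁻¹) := by group

theorem bracket_add_right (φ : GroupFilter G M) (s t : M) [NeZero t] (u : φ.Component s)
    (v v' : φ.Component t) :
    φ.bracket s t u (v + v') = φ.bracket s t u v + φ.bracket s t u v' := by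
  obtain ⟨x, rfl⟩ := φ.toComponent_surjective s u
  obtain ⟨y, rfl⟩ := φ.toComponent_surjective t v
  obtain ⟨y', rfl⟩ := φ.toComponent_surjective t v'
  rw [← toComponent_mul]
  simp only [bracket_toComponent]
  rw [← toComponent_mul, toComponent_eq_iff, ← QuotientGroup.eq]
  have h2 := φ.commutator_le s t (Subgroup.commutator_mem_commutator x.2 y'.2)
  have h1 : (y : G) ∈ φ t := y.2
  have h : Commute ((y : G) : G ⧸ φ.boundary (s + t))
      ((⁅(x : G), (y' : G)⁆ : G) : G ⧸ φ.boundary (s + t)) := by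
    rw [← commutatorElement_eq_one_iff_commute]
    refine (QuotientGroup.eq_one_iff _).2 (φ.le_boundary (s + t) (NeZero.ne t) ?_)
    rw [add_comm (s + t) t]
    exact φ.commutator_le t (s + t) (Subgroup.commutator_mem_commutator h1 h2)
  simp only [commutatorElement_def, QuotientGroup.mk_mul, QuotientGroup.mk_inv,
    Subgroup.coe_mul] at h ⊢
  generalize ((x : G) : G ⧸ φ.boundary (s + t)) = X at *
  generalize ((y : G) : G ⧸ φ.boundary (s + t)) = Y at *
  generalize ((y' : G) : G ⧸ φ.boundary (s + t)) = Y' at *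
  calc X * (Y * Y') * X⁻¹ * (Y * Y')⁻¹ = X * Y * X⁻¹ * Y⁻¹ * (Y * (X * Y' * X⁻¹ * Y'⁻¹)) * Y⁻¹ := by
        group
    _ = X * Y * X⁻¹ * Y⁻¹ * ((X * Y' * X⁻¹ * Y'⁻¹) * Y) * Y⁻¹ := by rw [h.eq]
    _ = X * Y * X⁻¹ * Y⁻¹ * (X * Y' * X⁻¹ * Y'⁻¹) := by group

theorem bracket_zero_left (φ : GroupFilter G M) (s t : M) [NeZero s] (v : φ.Component t) :
    φ.bracket s t 0 v = 0 := by
  have h := φ.bracket_add_left s t 0 0 v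
  rw [add_zero] at h
  exact left_eq_add.1 h

theorem bracket_zero_right (φ : GroupFilter G M) (s t : M) [NeZero t] (u : φ.Component s) :
    φ.bracket s t u 0 = 0 := by
  have h := φ.bracket_add_right s t u 0 0
  rw [add_zero] at h
  exact left_eq_add.1 h

theorem bracket_neg_left (φ : GroupFilter G M) (s t : M) [NeZero s] (u : φ.Component s)
    (v : φ.Component t) : φ.bracket s t (-u) v = -φ.bracket s t u v := by
  rw [eq_neg_iff_add_eq_zero, ← bracket_add_left, neg_add_cancel, bracket_zero_left]

theorem bracket_neg_right (φ : GroupFilter G M) (s t : M) [NeZero t] (u : φ.Component s)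
    (v : φ.Component t) : φ.bracket s t u (-v) = -φ.bracket s t u v := by
  rw [eq_neg_iff_add_eq_zero, ← bracket_add_right, neg_add_cancel, bracket_zero_right]

/-! ### The adjoint ring -/

/-- The adjoint ring of `[,] : L_s × L_t → L_{s+t}`: all pairs `(X, Y)` of additive endomorphisms,
`X` acting on `L_s` from the right and `Y` acting on `L_t` from the left, such that
`[u X, v] = [u, Y v]`. Mathlib writes endomorphisms on the left, so a ring of endomorphisms acting
from the right is the opposite of `AddMonoid.End`. -/
def adjointRing (φ : GroupFilter G M) (s t : M) [NeZero s] [NeZero t] :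
    Subring ((AddMonoid.End (φ.Component s))ᵐᵒᵖ × AddMonoid.End (φ.Component t)) where
  carrier := {a | ∀ (u : φ.Component s) (v : φ.Component t),
    φ.bracket s t (a.1.unop u) v = φ.bracket s t u (a.2 v)}
  mul_mem' := by
    intro a b ha hb u v
    change φ.bracket s t (b.1.unop (a.1.unop u)) v = φ.bracket s t u (a.2 (b.2 v))
    rw [hb, ha]
  one_mem' := fun u v => rfl
  add_mem' := by
    intro a b ha hb u v
    change φ.bracket s t (a.1.unop u + b.1.unop u) v = φ.bracket s t u (a.2 v + b.2 v)
    rw [bracket_add_left, bracket_add_right, ha, hb]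
  zero_mem' := by
    intro u v
    change φ.bracket s t 0 v = φ.bracket s t u 0
    rw [bracket_zero_left, bracket_zero_right]
  neg_mem' := by
    intro a ha u v
    change φ.bracket s t (-(a.1.unop u)) v = φ.bracket s t u (-(a.2 v))
    rw [bracket_neg_left, bracket_neg_right, ha]

/-- The power `J^i` of the Jacobson radical `J` of a ring `R`: `J^0 = R` and `J^(i+1) = J^i J`. -/
def radicalPower (R : Type*) [Ring R] (i : ℕ) : Ideal R := Ring.jacobson R ^ i

/-- The subgroup `L_s J^i` of `L_s`, with `J` the Jacobson radical of the adjoint ring of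
`[,] : L_s × L_s → L_{s+s}`. -/
def componentRadical (φ : GroupFilter G M) (s : M) [NeZero s] (i : ℕ) :
    AddSubgroup (φ.Component s) :=
  AddSubgroup.closure {w | ∃ (u : φ.Component s) (a : φ.adjointRing s s),
    a ∈ radicalPower (φ.adjointRing s s) i ∧ w = a.1.1.unop u}

/-- The subgroup `H_i` with `φ_s⁺ ≤ H_i ≤ φ_s` and `H_i / φ_s⁺ = L_s J^i`. -/
def radicalSubgroup (φ : GroupFilter G M) (s : M) [NeZero s] (i : ℕ) : Subgroup G where
  carrier := {x | ∃ hx : x ∈ φ s, φ.toComponent s ⟨x, hx⟩ ∈ φ.componentRadical s i}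
  mul_mem' := by
    rintro x y ⟨hx, hx'⟩ ⟨hy, hy'⟩
    exact ⟨(φ s).mul_mem hx hy, (φ.componentRadical s i).add_mem hx' hy'⟩
  one_mem' := ⟨(φ s).one_mem, (φ.componentRadical s i).zero_mem⟩
  inv_mem' := by
    rintro x ⟨hx, hx'⟩
    exact ⟨(φ s).inv_mem hx, (φ.componentRadical s i).neg_mem hx'⟩

end GroupFilter

/-! ### Generated filters and lex-least adjoint refinements -/

/-- The iterated commutator `[A₁, …, A_d]`, with `[A₁] = A₁` and
`[A₁, …, A_{m+1}] = [[A₁, …, A_m], A_{m+1}]` (the empty list is never used). -/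
def iteratedCommutator {G : Type*} [Group G] : List (Subgroup G) → Subgroup G
  | [] => ⊥
  | A :: l => l.foldl (fun B C => ⁅B, C⁆) A

/-- The function `M → 2^G` generated by `π : X → 2^G`, where `X` generates `M`: its value at `s` is
the product of the `[π_{s₁}, …, π_{s_d}]` over all sequences `s₁, …, s_d` (`d ≥ 1`) in `X` with
`s = s₁ + ⋯ + s_d`. (Only the values of `π` on `X` matter.) -/
def generatedSeries {G M : Type*} [Group G] [AddCommMonoid M] (X : Set M) (π : M → Subgroup G)
    (s : M) : Subgroup G :=
  ⨆ (l : List M) (_ : l ≠ [] ∧ (∀ x ∈ l, x ∈ X) ∧ l.sum = s), iteratedCommutator (l.map π)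

/-- For a filter `φ` on `ℕ` and `s ≠ 0`, the series on `ℕ × ℕ` generated by
`α_u^i = φ_u` if `i = 0` or `u ≠ s`, and `α_s^i = H_i`, on the set of all `(u, i)` that precede
`(s + 1, 0)` in the lexicographic order in which the first coordinate is the more significant. -/
noncomputable def adjointRefinement {G : Type*} [Group G] (φ : GroupFilter G ℕ) (s : ℕ) [NeZero s] :
    ℕ × ℕ → Subgroup G :=
  generatedSeries {x : ℕ × ℕ | toLex x < toLex (s + 1, 0)}
    (fun x => if x.2 = 0 ∨ x.1 ≠ s then φ x.1 else φ.radicalSubgroup s x.2)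

/-- `α` is the lex-least adjoint refinement of the filter `φ` on `ℕ`: the one that refines the first
component `L_s ≠ 0` with `s ≠ 0`. -/
def IsLexLeastAdjointRefinement {G : Type*} [Group G] (φ : GroupFilter G ℕ)
    (α : ℕ × ℕ → Subgroup G) : Prop :=
  ∃ (s : ℕ) (_ : NeZero s), IsLeast {t : ℕ | t ≠ 0 ∧ φ.boundary t ≠ φ t} s ∧
    α = adjointRefinement φ s

/-! ### The exponent-`p` central series -/

/-- The exponent-`p` central series of `G`: `η_0 = η_1 = G` and `η_{i+1} = [G, η_i] η_i^p` for
`i > 0`, where `η_i^p` is the subgroup generated by the `p`-th powers of the elements of `η_i`. -/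
def etaSeries (p : ℕ) (G : Type*) [Group G] : ℕ → Subgroup G
  | 0 => ⊤
  | 1 => ⊤
  | i + 2 => ⁅(⊤ : Subgroup G), etaSeries p G (i + 1)⁆ ⊔
      Subgroup.closure {x | ∃ y ∈ etaSeries p G (i + 1), x = y ^ p}

namespace etaSeries

open scoped commutatorElement

variable (p : ℕ) (G : Type*) [Group G]

theorem succ_succ (i : ℕ) : etaSeries p G (i + 2) = ⁅(⊤ : Subgroup G), etaSeries p G (i + 1)⁆ ⊔
    Subgroup.closure {x | ∃ y ∈ etaSeries p G (i + 1), x = y ^ p} := by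
  rw [etaSeries]

theorem normal_aux (i : ℕ) : (etaSeries p G i).Normal ∧ (etaSeries p G (i + 1)).Normal := by
  induction i with
  | zero => rw [etaSeries, etaSeries]; exact ⟨inferInstance, inferInstance⟩
  | succ i ih =>
    refine ⟨ih.2, ?_⟩
    have := ih.2
    have : (Subgroup.closure {x | ∃ y ∈ etaSeries p G (i + 1), x = y ^ p}).Normal := by
      refine ⟨fun n hn g => ?_⟩
      suffices h : Subgroup.closure {x | ∃ y ∈ etaSeries p G (i + 1), x = y ^ p} ≤
          (Subgroup.closure {x | ∃ y ∈ etaSeries p G (i + 1), x = y ^ p}).comap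
            (MulAut.conj g).toMonoidHom from h hn
      rw [Subgroup.closure_le]
      rintro _ ⟨y, hy, rfl⟩
      refine Subgroup.subset_closure ⟨g * y * g⁻¹, ‹(etaSeries p G (i + 1)).Normal›.conj_mem y hy g,
        ?_⟩
      simp
    rw [succ_succ]
    infer_instance

instance normal (i : ℕ) : (etaSeries p G i).Normal := (normal_aux p G i).1

theorem commutator_top_le (i : ℕ) : ⁅(⊤ : Subgroup G), etaSeries p G i⁆ ≤ etaSeries p G (i + 1) := by
  cases i with
  | zero => simp [etaSeries]
  | succ i => rw [succ_succ]; exact le_sup_left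

theorem pow_mem {i : ℕ} {x : G} (hx : x ∈ etaSeries p G i) : x ^ p ∈ etaSeries p G (i + 1) := by
  cases i with
  | zero => simp [etaSeries]
  | succ i =>
    rw [succ_succ]
    exact Subgroup.mem_sup_right (Subgroup.subset_closure ⟨x, hx, rfl⟩)

theorem succ_le (i : ℕ) : etaSeries p G (i + 1) ≤ etaSeries p G i := by
  cases i with
  | zero => simp [etaSeries]
  | succ i =>
    rw [succ_succ, sup_le_iff, Subgroup.closure_le]
    refine ⟨Subgroup.commutator_le_right _ _, ?_⟩
    rintro _ ⟨y, hy, rfl⟩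
    exact Subgroup.pow_mem _ hy p

theorem antitone : Antitone (etaSeries p G) := antitone_nat_of_succ_le (succ_le p G)

theorem commutator_le (i j : ℕ) :
    ⁅etaSeries p G i, etaSeries p G j⁆ ≤ etaSeries p G (i + j) := by
  induction i generalizing j with
  | zero => rw [zero_add]; exact Subgroup.commutator_le_right _ _
  | succ i ih =>
    cases i with
    | zero =>
      rw [zero_add, add_comm 1 j]
      exact (Subgroup.commutator_mono le_top le_rfl).trans (commutator_top_le p G j)
    | succ i =>
      have e : i + 1 + 1 + j = (i + 1 + j) + 1 := by omega
      rw [e]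
      set N := etaSeries p G ((i + 1 + j) + 1) with hN
      let f := QuotientGroup.mk' N
      have hker : ∀ {A B : Subgroup G}, ⁅A, B⁆ ≤ N → ⁅A.map f, B.map f⁆ = ⊥ := by
        intro A B h
        rw [← Subgroup.map_commutator, Subgroup.map_eq_bot_iff, QuotientGroup.ker_mk']
        exact h
      have h3 : ⁅⁅(⊤ : Subgroup G).map f, (etaSeries p G (i + 1)).map f⁆,
          (etaSeries p G j).map f⁆ = ⊥ := by
        apply Subgroup.commutator_commutator_eq_bot_of_rotate
        · rw [← Subgroup.map_commutator]
          refine hker ((Subgroup.commutator_mono (ih j) le_rfl).trans ?_)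
          rw [Subgroup.commutator_comm]
          exact commutator_top_le p G (i + 1 + j)
        · rw [← Subgroup.map_commutator]
          refine hker ?_
          rw [Subgroup.commutator_comm ⁅_, _⁆, Subgroup.commutator_comm (etaSeries p G j)]
          exact (Subgroup.commutator_mono le_rfl (commutator_top_le p G j)).trans (ih (j + 1))
      have key : etaSeries p G (i + 2) ≤
          (Subgroup.centralizer (((etaSeries p G j).map f : Subgroup (G ⧸ N)) :
            Set (G ⧸ N))).comap f := by
        rw [succ_succ, sup_le_iff]
        constructor
        · rw [← Subgroup.map_le_iff_le_comap, Subgroup.map_commutator]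
          exact Subgroup.commutator_eq_bot_iff_le_centralizer.1 h3
        · rw [Subgroup.closure_le]
          rintro _ ⟨x, hx, rfl⟩
          rw [SetLike.mem_coe, Subgroup.mem_comap, Subgroup.mem_centralizer_iff]
          rintro _ ⟨y, hy, rfl⟩
          have hz := ih j (Subgroup.commutator_mem_commutator hx hy)
          have hc : ∀ g : G, Commute (f g) (f ⁅x, y⁆) := by
            intro g
            rw [← commutatorElement_eq_one_iff_commute, ← map_commutatorElement]
            exact (QuotientGroup.eq_one_iff _).2 (commutator_top_le p G _
              (Subgroup.commutator_mem_commutator (Subgroup.mem_top g) hz))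
          have hp : f ⁅x, y⁆ ^ p = 1 := by
            rw [← map_pow]
            exact (QuotientGroup.eq_one_iff _).2 (pow_mem p G hz)
          have h1 : f y * f x * (f y)⁻¹ = f x * (f ⁅x, y⁆)⁻¹ := by
            rw [(hc x).inv_right.eq, map_commutatorElement, commutatorElement_def]
            group
          have h2 : (f y * f x * (f y)⁻¹) ^ p = f x ^ p := by
            rw [h1, (hc x).inv_right.mul_pow, inv_pow, hp, inv_one, mul_one]
          rw [conj_pow] at h2
          rw [map_pow]
          exact mul_inv_eq_iff_eq_mul.1 h2
      have h4 : ⁅(etaSeries p G (i + 2)).map f, (etaSeries p G j).map f⁆ = ⊥ :=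
        Subgroup.commutator_eq_bot_iff_le_centralizer.2 (Subgroup.map_le_iff_le_comap.2 key)
      rw [← Subgroup.map_commutator, Subgroup.map_eq_bot_iff, QuotientGroup.ker_mk'] at h4
      exact h4

end etaSeries

/-- The exponent-`p` central series of `G` as a filter on `ℕ`. -/
def etaFilter (p : ℕ) (G : Type*) [Group G] : GroupFilter G ℕ where
  toFun := etaSeries p G
  map_zero := by rw [etaSeries]
  commutator_le := etaSeries.commutator_le p G
  map_add_le s t := le_inf (etaSeries.antitone p G (Nat.le_add_right s t))
    (etaSeries.antitone p G (Nat.le_add_left t s))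

/-! Let `R` be a commutative ring and `β : A × C → W` an `R`-bilinear map of `𝔽_p`-spaces that is
separating on both sides. The Heisenberg group of `β` has `L_1 = A × C`, and its bracket
`L_1 × L_1 → L_2` is again `R`-bilinear and separating; such a ring of scalars lies in the centre of
the adjoint ring. A nilpotent `x ∈ R` therefore lies in `J`, so that `x ^ m L_1 ≤ L_1 J ^ m`, and if
`x ^ m` is not zero on `L_1`, then `H_0 > H_1 > ⋯ > H_{m+1}` because `J` is nilpotent.

Take `R = 𝔽_p[x] / (x ^ (m + 1))` and let it act through its residue field on vector spaces `U ≤ V`.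
Every bilinear map `T : U × V → V` extends to the separating map
`((u, q), (v, s)) ↦ (T u v + q v + s u, q s)` from `(U × R) × (V × R)` to `V × R`. The Heisenberg
groups so obtained have order `p ^ n` with `n = dim U + 2 dim V + 3 dim R`. As `T` is read off from
the images of bases of `A`, `C` and `W`, each isomorphism class contains at most `p ^ (n ^ 2)` of
the `p ^ (dim U (dim V) ^ 2)` groups. For `dim U ≈ dim V ≈ n / 3` the exponent is about
`n ^ 3 / 27`, more than the required `2 n ^ 3 / 729`. -/

theorem mem_jacobson_of_isNilpotent_of_commute {A : Type*} [Ring A] {z : A} (hz : IsNilpotent z)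
    (hc : ∀ a : A, Commute a z) : z ∈ Ring.jacobson A := by
  rw [Ring.jacobson_eq_sInf_isMaximal, Submodule.mem_sInf]
  intro I hI
  by_contra hzI
  obtain ⟨y, i, hi, h⟩ := hI.exists_inv hzI
  have hu : IsUnit i := by
    rw [← eq_sub_iff_add_eq'] at h
    exact h ▸ ((hc y).isNilpotent_mul_left hz).isUnit_one_sub
  exact hI.ne_top (Ideal.eq_top_of_isUnit_mem I hi hu)

/-! ### The radical filtration of a component -/

namespace GroupFilter

section RadicalFiltration

variable {G M : Type*} [Group G] [AddCommMonoid M] (φ : GroupFilter G M) (s : M)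

theorem apply_add_le (t : M) : φ (s + t) ≤ φ s := (φ.map_add_le s t).trans inf_le_left

theorem boundary_le : φ.boundary s ≤ φ s := iSup₂_le fun t _ => φ.apply_add_le s t

variable [NeZero s]

theorem unop_mem_componentRadical {i : ℕ} {a : φ.adjointRing s s}
    (ha : a ∈ radicalPower (φ.adjointRing s s) i) (u : φ.Component s) :
    a.1.1.unop u ∈ φ.componentRadical s i :=
  AddSubgroup.subset_closure ⟨u, a, ha, rfl⟩

theorem componentRadical_antitone : Antitone (φ.componentRadical s) := by
  intro i j hij
  rw [componentRadical, AddSubgroup.closure_le]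
  rintro _ ⟨u, a, ha, rfl⟩
  exact φ.unop_mem_componentRadical s (Ideal.pow_le_pow_right hij ha) u

theorem componentRadical_zero : φ.componentRadical s 0 = ⊤ := by
  refine eq_top_iff.2 fun u _ => ?_
  have h : (1 : φ.adjointRing s s) ∈ radicalPower (φ.adjointRing s s) 0 :=
    Submodule.one_le.1 (Submodule.pow_zero _).ge
  exact φ.unop_mem_componentRadical s h u

theorem componentRadical_succ (i : ℕ) :
    φ.componentRadical s (i + 1) = AddSubgroup.closure {w | ∃ u ∈ φ.componentRadical s i,
      ∃ c ∈ Ring.jacobson (φ.adjointRing s s), w = c.1.1.unop u} := by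
  have hsucc : radicalPower (φ.adjointRing s s) (i + 1) =
      radicalPower (φ.adjointRing s s) i * Ring.jacobson (φ.adjointRing s s) :=
    Submodule.pow_succ _
  refine le_antisymm ((AddSubgroup.closure_le _).2 ?_) ((AddSubgroup.closure_le _).2 ?_)
  · rintro _ ⟨u, a, ha, rfl⟩
    rw [hsucc] at ha
    refine Submodule.mul_induction_on ha (fun b hb c hc => ?_) fun b c hb hc => add_mem hb hc
    exact AddSubgroup.subset_closure ⟨_, φ.unop_mem_componentRadical s hb u, c, hc, rfl⟩
  · rintro _ ⟨u, hu, c, hc, rfl⟩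
    suffices h : φ.componentRadical s i ≤ (φ.componentRadical s (i + 1)).comap c.1.1.unop from h hu
    rw [componentRadical, AddSubgroup.closure_le]
    rintro _ ⟨v, b, hb, rfl⟩
    exact φ.unop_mem_componentRadical s (hsucc ▸ Ideal.mul_mem_mul hb hc) v

theorem exists_componentRadical_eq_bot [Finite (φ.Component s)] :
    ∃ N, φ.componentRadical s N = ⊥ := by
  have : Finite (AddMonoid.End (φ.Component s)) := DFunLike.finite _
  have : Finite (AddMonoid.End (φ.Component s))ᵐᵒᵖ := Finite.of_equiv _ MulOpposite.opEquiv
  obtain ⟨N, hN⟩ := IsSemiprimaryRing.isNilpotent (R := φ.adjointRing s s)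
  refine ⟨N, AddSubgroup.closure_eq_bot_iff.2 ?_⟩
  rintro _ ⟨u, a, ha, rfl⟩
  rw [radicalPower, hN] at ha
  rw [(Submodule.mem_bot _).1 ha]
  rfl

theorem componentRadical_succ_lt [Finite (φ.Component s)] {i : ℕ}
    (h : φ.componentRadical s i ≠ ⊥) : φ.componentRadical s (i + 1) < φ.componentRadical s i := by
  refine (φ.componentRadical_antitone s i.le_succ).lt_of_ne fun he => h ?_
  have hconst : ∀ k, φ.componentRadical s (i + k) = φ.componentRadical s i := by
    intro k
    induction k with
    | zero => rfl
    | succ k ih => rw [← add_assoc, componentRadical_succ, ih, ← componentRadical_succ, he]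
  obtain ⟨N, hN⟩ := φ.exists_componentRadical_eq_bot s
  exact le_bot_iff.1 (hconst N ▸ hN ▸ φ.componentRadical_antitone s (Nat.le_add_left N i))

theorem mem_radicalSubgroup_iff {i : ℕ} (x : φ s) :
    (x : G) ∈ φ.radicalSubgroup s i ↔ φ.toComponent s x ∈ φ.componentRadical s i :=
  ⟨fun h => h.2, fun h => ⟨x.2, h⟩⟩

theorem radicalSubgroup_antitone : Antitone (φ.radicalSubgroup s) :=
  fun _ _ hij _ hx => ⟨hx.1, φ.componentRadical_antitone s hij hx.2⟩

theorem radicalSubgroup_zero : φ.radicalSubgroup s 0 = φ s := by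
  refine le_antisymm (fun x hx => hx.1) fun x hx => ⟨hx, ?_⟩
  rw [componentRadical_zero]
  trivial

theorem boundary_le_radicalSubgroup (i : ℕ) : φ.boundary s ≤ φ.radicalSubgroup s i := by
  intro x hx
  refine ⟨φ.boundary_le s hx, ?_⟩
  have h : φ.toComponent s ⟨x, φ.boundary_le s hx⟩ = φ.toComponent s 1 := by
    rw [toComponent_eq_iff]
    simpa using hx
  rw [h]
  exact zero_mem _

theorem radicalSubgroup_succ_lt [Finite (φ.Component s)] {i : ℕ}
    (h : φ.componentRadical s i ≠ ⊥) : φ.radicalSubgroup s (i + 1) < φ.radicalSubgroup s i := by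
  refine (φ.radicalSubgroup_antitone s i.le_succ).lt_of_not_ge fun hle =>
    (φ.componentRadical_succ_lt s h).not_ge fun u hu => ?_
  obtain ⟨x, rfl⟩ := φ.toComponent_surjective s u
  exact (φ.mem_radicalSubgroup_iff s x).1 (hle ((φ.mem_radicalSubgroup_iff s x).2 hu))

end RadicalFiltration

end GroupFilter

/-! ### The length of the adjoint refinement -/

theorem iteratedCommutator_le_commutator {G : Type*} [Group G] {l : List (Subgroup G)}
    (hl : 2 ≤ l.length) : iteratedCommutator l ≤ commutator G := by
  have hfold : ∀ (l : List (Subgroup G)) (C : Subgroup G), C ≤ commutator G →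
      l.foldl (fun B C => ⁅B, C⁆) C ≤ commutator G := by
    intro l
    induction l with
    | nil => exact fun C hC => hC
    | cons _ _ ih => exact fun _ _ => ih _ (Subgroup.commutator_mono le_top le_top)
  match l with
  | A :: B :: l => exact hfold l ⁅A, B⁆ (Subgroup.commutator_mono le_top le_top)

section AdjointRefinement

variable {G : Type*} [Group G] (φ : GroupFilter G ℕ) (s : ℕ) [NeZero s]

theorem radicalSubgroup_le_adjointRefinement (i : ℕ) :
    φ.radicalSubgroup s i ≤ adjointRefinement φ s (s, i) := by
  refine le_iSup₂_of_le [(s, i)] ⟨by simp, ?_, by simp⟩ ?_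
  · simp [Prod.Lex.toLex_lt_toLex]
  · rcases eq_or_ne i 0 with rfl | hi
    · simp [iteratedCommutator, φ.radicalSubgroup_zero]
    · simp [iteratedCommutator, hi]

theorem adjointRefinement_le_radicalSubgroup (hG : commutator G ≤ φ.boundary s) {i : ℕ}
    {x : ℕ × ℕ} (hx : toLex (s, i) ≤ toLex x) :
    adjointRefinement φ s x ≤ φ.radicalSubgroup s i := by
  refine iSup₂_le fun l hl => ?_
  match l, hl with
  | [y], ⟨_, hlt, hsum⟩ =>
    obtain ⟨u, j⟩ := y
    obtain rfl : (u, j) = x := by simpa using hsum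
    obtain ⟨rfl, hij⟩ : u = s ∧ i ≤ j := by
      have := hlt (u, j) (by simp)
      simp only [Set.mem_ofPred_eq, Prod.Lex.toLex_lt_toLex, Prod.Lex.toLex_le_toLex] at this hx
      omega
    rcases eq_or_ne j 0 with rfl | hj
    · simpa [iteratedCommutator, ← φ.radicalSubgroup_zero] using φ.radicalSubgroup_antitone u hij
    · simpa [iteratedCommutator, hj] using φ.radicalSubgroup_antitone u hij
  | y :: z :: l, _ =>
    exact (iteratedCommutator_le_commutator (by simp)).trans
      (hG.trans (φ.boundary_le_radicalSubgroup s i))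

theorem seriesBoundary_adjointRefinement_le (hG : commutator G ≤ φ.boundary s) (i : ℕ) :
    seriesBoundary (adjointRefinement φ s) (s, i) ≤ φ.radicalSubgroup s (i + 1) := by
  refine iSup₂_le fun t ht => adjointRefinement_le_radicalSubgroup φ s hG ?_
  rw [Ne, Prod.ext_iff, Prod.fst_zero, Prod.snd_zero] at ht
  rw [Prod.Lex.toLex_le_toLex, Prod.fst_add, Prod.snd_add]
  omega

theorem le_seriesLength_adjointRefinement [Finite (φ.Component s)]
    (hG : commutator G ≤ φ.boundary s) {m : ℕ} (hm : φ.componentRadical s m ≠ ⊥) :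
    (m + 1 : ℕ∞) ≤ seriesLength (adjointRefinement φ s) := by
  calc (m + 1 : ℕ∞) = ((Prod.mk s) '' Set.Iic m).encard := by
        rw [(Prod.mk_right_injective s).encard_image, ← Finset.coe_Iic,
          Set.encard_coe_eq_coe_finsetCard, Nat.card_Iic, Nat.cast_succ]
    _ ≤ seriesLength (adjointRefinement φ s) := by
        refine Set.encard_le_encard ?_
        rintro _ ⟨i, hi, rfl⟩
        have hne : φ.componentRadical s i ≠ ⊥ := fun h0 =>
          hm (le_bot_iff.1 (h0 ▸ φ.componentRadical_antitone s hi))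
        refine ⟨fun h => NeZero.ne s (congrArg Prod.fst h), LT.lt.ne ?_⟩
        exact (seriesBoundary_adjointRefinement_le φ s hG i).trans_lt
          ((φ.radicalSubgroup_succ_lt s hne).trans_le (radicalSubgroup_le_adjointRefinement φ s i))

end AdjointRefinement

/-! ### The `η` series -/

section EtaSeries

variable {p : ℕ} {G : Type*} [Group G]

theorem etaFilter_boundary (s : ℕ) : (etaFilter p G).boundary s = etaSeries p G (s + 1) :=
  le_antisymm (iSup₂_le fun _ ht => etaSeries.antitone p G
    (Nat.add_le_add_left (Nat.one_le_iff_ne_zero.2 ht) s))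
    ((etaFilter p G).le_boundary s one_ne_zero)

theorem etaFilter_apply (s : ℕ) : etaFilter p G s = etaSeries p G s := rfl

theorem etaFilter_one : etaFilter p G 1 = ⊤ := by rw [etaFilter_apply, etaSeries]

theorem seriesLength_etaFilter_eq_two (h2 : etaSeries p G 2 ≠ ⊤) (h2' : etaSeries p G 2 ≠ ⊥)
    (h3 : etaSeries p G 3 = ⊥) : seriesLength (etaFilter p G) = 2 := by
  have hsupp : {s : ℕ | s ≠ 0 ∧ (etaFilter p G).boundary s ≠ etaFilter p G s} = {1, 2} := by
    ext s
    simp only [Set.mem_ofPred_eq, etaFilter_boundary, Set.mem_insert_iff, Set.mem_singleton_iff]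
    match s with
    | 0 => simp
    | 1 => simpa [etaFilter_one] using h2
    | 2 => simpa [etaFilter_apply, h3] using h2'.symm
    | s + 3 =>
      have hbot : ∀ k, 3 ≤ k → etaSeries p G k = ⊥ := fun k hk =>
        le_bot_iff.1 (h3 ▸ etaSeries.antitone p G hk)
      simp [etaFilter_apply, hbot (s + 3) (by omega), hbot (s + 3 + 1) (by omega)]
  exact (congrArg Set.encard hsupp).trans (Set.encard_pair (by norm_num))

theorem isLexLeastAdjointRefinement_one (h2 : etaSeries p G 2 ≠ ⊤) :
    IsLexLeastAdjointRefinement (etaFilter p G) (adjointRefinement (etaFilter p G) 1) := by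
  refine ⟨1, inferInstance, ⟨⟨one_ne_zero, ?_⟩, fun t ht => Nat.one_le_iff_ne_zero.2 ht.1⟩, rfl⟩
  rwa [etaFilter_boundary, etaFilter_one]

theorem commutator_le_etaFilter_boundary_one : commutator G ≤ (etaFilter p G).boundary 1 := by
  rw [etaFilter_boundary, commutator_def, ← etaFilter_one (p := p)]
  exact (etaFilter p G).commutator_le 1 1

end EtaSeries

/-! ### Scalars acting through the adjoint ring -/

namespace GroupFilter

variable {G M : Type*} [Group G] [AddCommMonoid M] (φ : GroupFilter G M) (s : M)

/-- The identification of `L_s` with `V` induced by a surjection `φ_s → V` with kernel `φ_s⁺`. -/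
noncomputable def componentEquiv {V : Type*} [AddGroup V] (f : φ s →* Multiplicative V)
    (hf : Function.Surjective f) (hker : f.ker = (φ.boundary s).subgroupOf (φ s)) :
    φ.Component s ≃+ V :=
  MulEquiv.toAdditiveLeft ((QuotientGroup.quotientMulEquivOfEq hker.symm).trans
    (QuotientGroup.quotientKerEquivOfSurjective f hf))

section Scalars

variable [NeZero s] {R : Type*} [CommRing R] [Module R (φ.Component s)]

/-- Scalars that can be moved across the bracket `L_s × L_s → L_{s+s}` are elements `(r, r)` of the
adjoint ring. -/
def scalarHom (hR : ∀ (r : R) u v, φ.bracket s s (r • u) v = φ.bracket s s u (r • v)) :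
    R →+* φ.adjointRing s s :=
  (((Module.toAddMonoidEnd R (φ.Component s)).toOpposite fun r t =>
    (Commute.all r t).map _).prod (Module.toAddMonoidEnd R (φ.Component s))).codRestrict _ hR

variable {Z : Type*} [AddCommGroup Z] [Module R Z]
  {b : φ.Component s →ₗ[R] φ.Component s →ₗ[R] Z} {ζ : Z → φ.Component (s + s)}

theorem bracket_smul_left (hb : ∀ u v, φ.bracket s s u v = ζ (b u v)) (r : R)
    (u v : φ.Component s) : φ.bracket s s (r • u) v = φ.bracket s s u (r • v) := by
  simp only [hb, map_smul, LinearMap.smul_apply]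

theorem commute_scalarHom (hζ : Function.Injective ζ) (hnd : b.Nondegenerate)
    (hb : ∀ u v, φ.bracket s s u v = ζ (b u v)) (r : R) (a : φ.adjointRing s s) :
    Commute a (φ.scalarHom s (φ.bracket_smul_left s hb) r) := by
  obtain ⟨⟨X, Y⟩, hXY⟩ := a
  have hXY' : ∀ u v, b (X.unop u) v = b u (Y v) := fun u v =>
    hζ ((hb _ _).symm.trans ((hXY u v).trans (hb _ _)))
  refine Subtype.ext (Prod.ext (MulOpposite.unop_injective ?_) ?_)
  · refine AddMonoidHom.ext fun u => sub_eq_zero.1 (hnd.1 _ fun v => ?_)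
    change b (r • X.unop u - X.unop (r • u)) v = 0
    simp only [map_sub, LinearMap.sub_apply, map_smul, LinearMap.smul_apply, hXY', sub_self]
  · refine AddMonoidHom.ext fun v => sub_eq_zero.1 (hnd.2 _ fun u => ?_)
    change b u (Y (r • v) - r • Y v) = 0
    simp only [map_sub, map_smul, ← hXY', sub_self]

theorem pow_smul_mem_componentRadical (hζ : Function.Injective ζ) (hnd : b.Nondegenerate)
    (hb : ∀ u v, φ.bracket s s u v = ζ (b u v)) {x : R} (hx : IsNilpotent x) (m : ℕ)
    (u : φ.Component s) : x ^ m • u ∈ φ.componentRadical s m := by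
  have hmem : φ.scalarHom s (φ.bracket_smul_left s hb) x ∈ Ring.jacobson (φ.adjointRing s s) :=
    mem_jacobson_of_isNilpotent_of_commute (hx.map _) (φ.commute_scalarHom s hζ hnd hb x)
  have hpow := Ideal.pow_mem_pow hmem m
  rw [← map_pow] at hpow
  exact φ.unop_mem_componentRadical s hpow u

end Scalars

end GroupFilter

/-! ### Heisenberg groups of bilinear maps -/

/-- The Heisenberg group of a bilinear map `β : A × C → W`: the set `A × C × W` with multiplication
`(a, c, w) (a', c', w') = (a + a', c + c', w + w' + β a c')`. -/
@[ext]
structure HeisenbergGroup {R A C W : Type*} [CommRing R] [AddCommGroup A] [AddCommGroup C]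
    [AddCommGroup W] [Module R A] [Module R C] [Module R W] (β : A →ₗ[R] C →ₗ[R] W) where
  left : A
  right : C
  central : W

namespace HeisenbergGroup

open scoped commutatorElement

variable {R A C W : Type*} [CommRing R] [AddCommGroup A] [AddCommGroup C] [AddCommGroup W]
  [Module R A] [Module R C] [Module R W] {β : A →ₗ[R] C →ₗ[R] W}

instance : Mul (HeisenbergGroup β) :=
  ⟨fun x y => ⟨x.left + y.left, x.right + y.right, x.central + y.central + β x.left y.right⟩⟩

instance : One (HeisenbergGroup β) := ⟨⟨0, 0, 0⟩⟩

instance : Inv (HeisenbergGroup β) :=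
  ⟨fun x => ⟨-x.left, -x.right, -x.central + β x.left x.right⟩⟩

@[simp] theorem mul_left (x y : HeisenbergGroup β) : (x * y).left = x.left + y.left := rfl
@[simp] theorem mul_right (x y : HeisenbergGroup β) : (x * y).right = x.right + y.right := rfl
@[simp] theorem mul_central (x y : HeisenbergGroup β) :
    (x * y).central = x.central + y.central + β x.left y.right := rfl
@[simp] theorem one_left : (1 : HeisenbergGroup β).left = 0 := rfl
@[simp] theorem one_right : (1 : HeisenbergGroup β).right = 0 := rfl
@[simp] theorem one_central : (1 : HeisenbergGroup β).central = 0 := rfl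
@[simp] theorem inv_left (x : HeisenbergGroup β) : x⁻¹.left = -x.left := rfl
@[simp] theorem inv_right (x : HeisenbergGroup β) : x⁻¹.right = -x.right := rfl
@[simp] theorem inv_central (x : HeisenbergGroup β) :
    x⁻¹.central = -x.central + β x.left x.right := rfl

instance : Group (HeisenbergGroup β) :=
  Group.ofLeftAxioms
    (fun x y z => by ext <;> simp <;> abel)
    (fun x => by ext <;> simp)
    (fun x => by ext <;> simp)

/-- The coordinates of the elements of a Heisenberg group. -/
def equivProd : HeisenbergGroup β ≃ A × C × W where
  toFun x := (x.left, x.right, x.central)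
  invFun x := ⟨x.1, x.2.1, x.2.2⟩

instance [Finite A] [Finite C] [Finite W] : Finite (HeisenbergGroup β) :=
  Finite.of_equiv _ equivProd.symm

theorem natCard : Nat.card (HeisenbergGroup β) = Nat.card A * (Nat.card C * Nat.card W) := by
  rw [Nat.card_congr equivProd, Nat.card_prod, Nat.card_prod]

theorem commutator_eq (x y : HeisenbergGroup β) :
    ⁅x, y⁆ = ⟨0, 0, β x.left y.right - β y.left x.right⟩ := by
  rw [commutatorElement_def]
  ext <;> simp; abel

variable (β)

/-- The embedding of `A` as an abelian subgroup. -/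
def leftHom : Multiplicative A →* HeisenbergGroup β where
  toFun a := ⟨a.toAdd, 0, 0⟩
  map_one' := rfl
  map_mul' a a' := by ext <;> simp

/-- The embedding of `C` as an abelian subgroup. -/
def rightHom : Multiplicative C →* HeisenbergGroup β where
  toFun c := ⟨0, c.toAdd, 0⟩
  map_one' := rfl
  map_mul' c c' := by ext <;> simp

/-- The embedding of `W` as a central subgroup. -/
def centralHom : Multiplicative W →* HeisenbergGroup β where
  toFun w := ⟨0, 0, w.toAdd⟩
  map_one' := rfl
  map_mul' w w' := by ext <;> simp

theorem centralHom_injective : Function.Injective (centralHom β) :=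
  fun _ _ h => congrArg HeisenbergGroup.central h

theorem commutatorElement_leftHom_rightHom (a : A) (c : C) :
    ⁅leftHom β (.ofAdd a), rightHom β (.ofAdd c)⁆ = centralHom β (.ofAdd (β a c)) := by
  rw [commutator_eq]
  simp [leftHom, rightHom, centralHom]

/-- The quotient map by the central subgroup `W`. -/
def proj : HeisenbergGroup β →* Multiplicative (A × C) where
  toFun x := .ofAdd (x.left, x.right)
  map_one' := rfl
  map_mul' _ _ := rfl

theorem proj_surjective : Function.Surjective (proj β) := fun v => ⟨⟨v.toAdd.1, v.toAdd.2, 0⟩, rfl⟩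

theorem ker_proj : (proj β).ker = (centralHom β).range := by
  refine le_antisymm ?_ (by rintro _ ⟨w, rfl⟩; rfl)
  rintro ⟨a, c, w⟩ h
  obtain ⟨rfl, rfl⟩ := Prod.ext_iff.1 (Multiplicative.ofAdd.injective h)
  exact ⟨.ofAdd w, rfl⟩

section EtaSeries

variable {β} {p : ℕ} [Module (ZMod p) A] [Module (ZMod p) C]

theorem etaSeries_two (hβ : ∀ w, ∃ a c, β a c = w) :
    etaSeries p (HeisenbergGroup β) 2 = (proj β).ker := by
  rw [etaSeries.succ_succ, zero_add, etaSeries]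
  refine le_antisymm (sup_le ?_ ?_) ?_
  · exact Subgroup.commutator_le.2 fun x _ y _ => by rw [commutator_eq]; rfl
  · rw [Subgroup.closure_le]
    rintro _ ⟨x, -, rfl⟩
    rw [SetLike.mem_coe, MonoidHom.mem_ker, map_pow]
    exact ZModModule.char_nsmul_eq_zero p (x.left, x.right)
  · rw [ker_proj]
    rintro _ ⟨w, rfl⟩
    obtain ⟨a, c, h⟩ := hβ w.toAdd
    have hw := commutatorElement_leftHom_rightHom β a c
    rw [h, ofAdd_toAdd] at hw
    rw [← hw]
    exact Subgroup.mem_sup_left (Subgroup.commutator_mem_commutator trivial trivial)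

theorem etaSeries_three [Module (ZMod p) W] (hβ : ∀ w, ∃ a c, β a c = w) :
    etaSeries p (HeisenbergGroup β) 3 = ⊥ := by
  rw [etaSeries.succ_succ, one_add_one_eq_two, etaSeries_two hβ, ker_proj, eq_bot_iff, sup_le_iff,
    Subgroup.commutator_le, Subgroup.closure_le]
  constructor
  · rintro x - _ ⟨w, rfl⟩
    rw [Subgroup.mem_bot, commutator_eq]
    ext <;> simp [centralHom]
  · rintro _ ⟨_, ⟨w, rfl⟩, rfl⟩
    rw [SetLike.mem_coe, Subgroup.mem_bot, ← map_pow,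
      show w ^ p = 1 from ZModModule.char_nsmul_eq_zero p w.toAdd, map_one]

theorem etaSeries_two_ne_top [Nontrivial A] (hβ : ∀ w, ∃ a c, β a c = w) :
    etaSeries p (HeisenbergGroup β) 2 ≠ ⊤ := by
  rw [etaSeries_two hβ]
  intro h
  obtain ⟨a, ha⟩ := exists_ne (0 : A)
  have hmem : (⟨a, 0, 0⟩ : HeisenbergGroup β) ∈ (proj β).ker := h ▸ Subgroup.mem_top _
  exact ha (congrArg Prod.fst (Multiplicative.ofAdd.injective hmem))

theorem etaSeries_two_ne_bot [Nontrivial W] (hβ : ∀ w, ∃ a c, β a c = w) :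
    etaSeries p (HeisenbergGroup β) 2 ≠ ⊥ := by
  rw [etaSeries_two hβ, ker_proj, Ne, MonoidHom.range_eq_bot_iff]
  intro h
  obtain ⟨w, hw⟩ := exists_ne (0 : W)
  exact hw (centralHom_injective β (DFunLike.congr_fun h (.ofAdd w)))

theorem seriesLength_etaFilter [Nontrivial A] [Nontrivial W] [Module (ZMod p) W]
    (hβ : ∀ w, ∃ a c, β a c = w) : seriesLength (etaFilter p (HeisenbergGroup β)) = 2 :=
  seriesLength_etaFilter_eq_two (etaSeries_two_ne_top hβ) (etaSeries_two_ne_bot hβ)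
    (etaSeries_three hβ)

end EtaSeries

section AdjointRefinement

/-- The alternating form `((a, c), (a', c')) ↦ β a c' - β a' c` describing commutators. -/
def alternation : A × C →ₗ[R] A × C →ₗ[R] W :=
  β.compl₁₂ (.fst R A C) (.snd R A C) - (β.compl₁₂ (.fst R A C) (.snd R A C)).flip

theorem alternation_apply (u v : A × C) : alternation β u v = β u.1 v.2 - β v.1 u.2 := rfl

variable {β}

theorem alternation_nondegenerate (hβ : β.Nondegenerate) : (alternation β).Nondegenerate := by
  have halt : (alternation β).IsAlt := fun u => sub_self _
  refine halt.isRefl.nondegenerate_iff_separatingLeft.2 fun u hu => Prod.ext ?_ ?_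
  · exact hβ.1 _ fun c => by simpa [alternation_apply] using hu (0, c)
  · exact hβ.2 _ fun a => by simpa [alternation_apply] using hu (a, 0)

variable {p : ℕ} [Module (ZMod p) A] [Module (ZMod p) C]

/-- For the `η` series of the Heisenberg group of `β : A × C → W`, the component `L_1` is
`A × C`. -/
noncomputable def componentOneEquiv (hβ : ∀ w, ∃ a c, β a c = w) :
    (etaFilter p (HeisenbergGroup β)).Component 1 ≃+ A × C :=
  (etaFilter p (HeisenbergGroup β)).componentEquiv 1
    ((proj β).comp (etaFilter p (HeisenbergGroup β) 1).subtype)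
    ((proj_surjective β).comp fun x => ⟨⟨x, by rw [etaFilter_one]; trivial⟩, rfl⟩)
    (by rw [etaFilter_boundary, etaSeries_two hβ]; rfl)

/-- The map `W → L_2` to the second component of the `η` series, through which all brackets of
elements of `L_1` factor. -/
def toComponentTwo (hβ : ∀ w, ∃ a c, β a c = w) (w : W) :
    (etaFilter p (HeisenbergGroup β)).Component (1 + 1) :=
  (etaFilter p (HeisenbergGroup β)).toComponent 2 ⟨centralHom β (.ofAdd w), by
    rw [etaFilter_apply, etaSeries_two hβ, ker_proj]; exact ⟨_, rfl⟩⟩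

theorem toComponentTwo_injective [Module (ZMod p) W] (hβ : ∀ w, ∃ a c, β a c = w) :
    Function.Injective (toComponentTwo (p := p) hβ) := by
  intro w w' h
  rw [toComponentTwo, toComponentTwo, GroupFilter.toComponent_eq_iff, etaFilter_boundary,
    etaSeries_three hβ, Subgroup.mem_bot, inv_mul_eq_one] at h
  exact centralHom_injective β h

theorem bracket_eq_alternation (hβ : ∀ w, ∃ a c, β a c = w)
    (u v : (etaFilter p (HeisenbergGroup β)).Component 1) :
    (etaFilter p (HeisenbergGroup β)).bracket 1 1 u v =
      toComponentTwo hβ (alternation β (componentOneEquiv hβ u) (componentOneEquiv hβ v)) := by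
  obtain ⟨x, rfl⟩ := GroupFilter.toComponent_surjective _ 1 u
  obtain ⟨y, rfl⟩ := GroupFilter.toComponent_surjective _ 1 v
  rw [GroupFilter.bracket_toComponent]
  exact congrArg _ (Subtype.ext (commutator_eq x.1 y.1))

theorem finite_component_one [Finite A] [Finite C] (hβ : ∀ w, ∃ a c, β a c = w) :
    Finite ((etaFilter p (HeisenbergGroup β)).Component 1) :=
  Finite.of_equiv _ (componentOneEquiv hβ).symm.toEquiv

theorem symm_pow_smul_mem_componentRadical [Module (ZMod p) W] (hβ : ∀ w, ∃ a c, β a c = w)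
    (hnd : β.Nondegenerate) {x : R} (hx : IsNilpotent x) (m : ℕ) (v : A × C) :
    (componentOneEquiv hβ).symm (x ^ m • v) ∈
      (etaFilter p (HeisenbergGroup β)).componentRadical 1 m := by
  let _ := (componentOneEquiv (p := p) hβ).module R
  let E : (etaFilter p (HeisenbergGroup β)).Component 1 ≃ₗ[R] A × C :=
    (componentOneEquiv hβ).linearEquiv R
  rw [show (componentOneEquiv hβ).symm (x ^ m • v) = x ^ m • E.symm v from map_smul E.symm _ _]
  exact GroupFilter.pow_smul_mem_componentRadical _ 1
    (b := E.symm.arrowCongr (E.symm.arrowCongr (.refl R W)) (alternation β))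
    (toComponentTwo_injective hβ) ((alternation_nondegenerate hnd).congr E.symm E.symm)
    (bracket_eq_alternation hβ) hx m _

theorem le_seriesLength_adjointRefinement [Finite A] [Finite C] [Module (ZMod p) W]
    (hβ : ∀ w, ∃ a c, β a c = w) (hnd : β.Nondegenerate) {x : R} (hx : IsNilpotent x) {m : ℕ}
    {v : A × C} (hv : x ^ m • v ≠ 0) :
    (m + 1 : ℕ∞) ≤ seriesLength (adjointRefinement (etaFilter p (HeisenbergGroup β)) 1) := by
  have := finite_component_one (p := p) hβ
  refine _root_.le_seriesLength_adjointRefinement _ 1 commutator_le_etaFilter_boundary_one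
    fun hbot => hv ?_
  have hmem := symm_pow_smul_mem_componentRadical (p := p) hβ hnd hx m v
  rwa [hbot, AddSubgroup.mem_bot, EmbeddingLike.map_eq_zero_iff] at hmem

end AdjointRefinement

end HeisenbergGroup

/-! ### Unital extensions of bilinear maps -/

section UnitalExtension

variable {R U V : Type*} [CommRing R] [AddCommGroup U] [AddCommGroup V] [Module R U] [Module R V]

/-- The extension `((u, q), (v, s)) ↦ (T u v + q v + s ι(u), q s)` of a bilinear map
`T : U × V → V`: the element `(0, 1)` on the left acts as the identity, and `(0, 1)` on the right as
`ι × id`. -/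
def unitalExtension (ι : U →ₗ[R] V) (T : U →ₗ[R] V →ₗ[R] V) : U × R →ₗ[R] V × R →ₗ[R] V × R :=
  LinearMap.mk₂ R (fun a c => (T a.1 c.1 + a.2 • c.1 + c.2 • ι a.1, a.2 * c.2))
    (fun a a' c => by ext <;> simp [add_smul, add_mul]; abel)
    (fun r a c => by ext <;> simp [mul_smul, mul_assoc, smul_comm c.2 r])
    (fun a c c' => by ext <;> simp [add_smul, mul_add]; abel)
    (fun r a c => by ext <;> simp [mul_smul, mul_left_comm, smul_comm a.2 r])

theorem unitalExtension_apply (ι : U →ₗ[R] V) (T : U →ₗ[R] V →ₗ[R] V) (a : U × R) (c : V × R) :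
    unitalExtension ι T a c = (T a.1 c.1 + a.2 • c.1 + c.2 • ι a.1, a.2 * c.2) := rfl

theorem unitalExtension_one_left (ι : U →ₗ[R] V) (T : U →ₗ[R] V →ₗ[R] V) (c : V × R) :
    unitalExtension ι T (0, 1) c = c := by simp [unitalExtension_apply]

theorem unitalExtension_one_right (ι : U →ₗ[R] V) (T : U →ₗ[R] V →ₗ[R] V) (a : U × R) :
    unitalExtension ι T a (0, 1) = (ι a.1, a.2) := by simp [unitalExtension_apply]

theorem exists_unitalExtension_eq (ι : U →ₗ[R] V) (T : U →ₗ[R] V →ₗ[R] V) (w : V × R) :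
    ∃ a c, unitalExtension ι T a c = w := ⟨(0, 1), w, unitalExtension_one_left ι T w⟩

theorem unitalExtension_nondegenerate {ι : U →ₗ[R] V} (hι : Function.Injective ι)
    (T : U →ₗ[R] V →ₗ[R] V) : (unitalExtension ι T).Nondegenerate := by
  constructor
  · intro a ha
    obtain ⟨hu, hq⟩ := Prod.ext_iff.1 ((unitalExtension_one_right ι T a).symm.trans (ha (0, 1)))
    exact Prod.ext ((map_eq_zero_iff ι hι).1 hu) hq
  · intro c hc
    exact (unitalExtension_one_left ι T c).symm.trans (hc (0, 1))

theorem unitalExtension_injective (ι : U →ₗ[R] V) : Function.Injective (unitalExtension ι) := by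
  intro T T' h
  ext u v
  simpa [unitalExtension_apply] using congrArg Prod.fst (LinearMap.congr_fun₂ h (u, 0) (v, 0))

end UnitalExtension

/-! ### Counting isomorphism classes -/

theorem natCard_monoidHom_le (p : ℕ) [Fact p.Prime] (A H : Type*) [AddCommGroup A]
    [Module (ZMod p) A] [Module.Finite (ZMod p) A] [Group H] [Finite H] :
    Nat.card (Multiplicative A →* H) ≤ Nat.card H ^ Module.finrank (ZMod p) A := by
  let b := Module.finBasis (ZMod p) A
  have hb : Function.Injective fun (f : Multiplicative A →* H) i => f (.ofAdd (b i)) := by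
    intro f g h
    let K := AddSubgroup.toZModSubmodule p (AddSubgroup.toSubgroup.symm (f.eqLocus g))
    have hK : K = ⊤ := by
      rw [eq_top_iff, ← b.span_eq, Submodule.span_le]
      rintro _ ⟨i, rfl⟩
      exact congrFun h i
    exact MonoidHom.ext fun a => (hK ▸ Submodule.mem_top : a.toAdd ∈ K)
  calc Nat.card (Multiplicative A →* H)
      ≤ Nat.card (Fin (Module.finrank (ZMod p) A) → H) := Nat.card_le_card_of_injective _ hb
    _ = Nat.card H ^ Module.finrank (ZMod p) A := by rw [Nat.card_fun, Nat.card_fin]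

namespace HeisenbergGroup

section Counting

open scoped commutatorElement

variable {R A C W : Type*} [CommRing R] [AddCommGroup A] [AddCommGroup C] [AddCommGroup W]
  [Module R A] [Module R C] [Module R W]

theorem eq_of_comp_leftHom_rightHom_centralHom {H : Type*} [Group H] {β β' : A →ₗ[R] C →ₗ[R] W}
    (e : HeisenbergGroup β ≃* H) (e' : HeisenbergGroup β' ≃* H)
    (hl : e.toMonoidHom.comp (leftHom β) = e'.toMonoidHom.comp (leftHom β'))
    (hr : e.toMonoidHom.comp (rightHom β) = e'.toMonoidHom.comp (rightHom β'))
    (hc : e.toMonoidHom.comp (centralHom β) = e'.toMonoidHom.comp (centralHom β')) : β = β' := by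
  ext a c
  refine Multiplicative.ofAdd.injective (centralHom_injective β' (e'.injective ?_))
  calc e' (centralHom β' (.ofAdd (β a c)))
      = e (centralHom β (.ofAdd (β a c))) := (DFunLike.congr_fun hc _).symm
    _ = ⁅e (leftHom β (.ofAdd a)), e (rightHom β (.ofAdd c))⁆ := by
        rw [← commutatorElement_leftHom_rightHom, map_commutatorElement]
    _ = ⁅e' (leftHom β' (.ofAdd a)), e' (rightHom β' (.ofAdd c))⁆ :=
        congrArg₂ _ (DFunLike.congr_fun hl _) (DFunLike.congr_fun hr _)
    _ = e' (centralHom β' (.ofAdd (β' a c))) := by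
        rw [← commutatorElement_leftHom_rightHom, map_commutatorElement]

variable (p : ℕ) [Fact p.Prime] [Module (ZMod p) A] [Module (ZMod p) C] [Module (ZMod p) W]
  [Module.Finite (ZMod p) A] [Module.Finite (ZMod p) C] [Module.Finite (ZMod p) W]

theorem natCard_eq_pow_finrank (β : A →ₗ[R] C →ₗ[R] W) :
    Nat.card (HeisenbergGroup β) = p ^ (Module.finrank (ZMod p) A + Module.finrank (ZMod p) C +
      Module.finrank (ZMod p) W) := by
  rw [natCard, Module.natCard_eq_pow_finrank (K := ZMod p) (V := A),
    Module.natCard_eq_pow_finrank (K := ZMod p) (V := C),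
    Module.natCard_eq_pow_finrank (K := ZMod p) (V := W), Nat.card_zmod, pow_add, pow_add,
    mul_assoc]

theorem natCard_nonempty_mulEquiv_le {ι : Type*} {β : ι → A →ₗ[R] C →ₗ[R] W}
    (hβ : Function.Injective β) (H : Type*) [Group H] [Finite H] :
    Nat.card {i // Nonempty (HeisenbergGroup (β i) ≃* H)} ≤ Nat.card H ^
      (Module.finrank (ZMod p) A + Module.finrank (ZMod p) C + Module.finrank (ZMod p) W) := by
  have : Finite A := Module.finite_of_finite (ZMod p)
  have : Finite C := Module.finite_of_finite (ZMod p)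
  have : Finite W := Module.finite_of_finite (ZMod p)
  have : Finite (Multiplicative A →* H) := DFunLike.finite _
  have : Finite (Multiplicative C →* H) := DFunLike.finite _
  have : Finite (Multiplicative W →* H) := DFunLike.finite _
  let e (i : {i // Nonempty (HeisenbergGroup (β i) ≃* H)}) : HeisenbergGroup (β i.1) ≃* H :=
    i.2.some
  have hinj : Function.Injective fun i => ((e i).toMonoidHom.comp (leftHom (β i.1)),
      (e i).toMonoidHom.comp (rightHom (β i.1)), (e i).toMonoidHom.comp (centralHom (β i.1))) := by
    intro i j hij
    simp only [Prod.mk.injEq] at hij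
    exact Subtype.ext (hβ (eq_of_comp_leftHom_rightHom_centralHom _ _ hij.1 hij.2.1 hij.2.2))
  refine (Nat.card_le_card_of_injective _ hinj).trans ?_
  rw [Nat.card_prod, Nat.card_prod, pow_add, pow_add, mul_assoc]
  gcongr <;> exact natCard_monoidHom_le p _ H

end Counting

end HeisenbergGroup

theorem exists_pairwise_nonisomorphic {ι : Type*} [Finite ι] (G : ι → Type*) [∀ i, Group (G i)]
    {B : ℕ} (hB : ∀ i, Nat.card {j // Nonempty (G j ≃* G i)} ≤ B) :
    ∃ (k : ℕ) (f : Fin k → ι), Nat.card ι ≤ B * k ∧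
      ∀ i j, i ≠ j → IsEmpty (G (f i) ≃* G (f j)) := by
  let S : Setoid ι := ⟨fun i j => Nonempty (G i ≃* G j), fun i => ⟨MulEquiv.refl _⟩,
    fun ⟨e⟩ => ⟨e.symm⟩, fun ⟨e⟩ ⟨e'⟩ => ⟨e.trans e'⟩⟩
  let E := (Finite.equivFin (Quotient S)).symm
  refine ⟨Nat.card (Quotient S), fun i => (E i).out, ?_, fun i j hij => ?_⟩
  · have := Fintype.ofFinite (Quotient S)
    have hclass (q : Quotient S) : Nat.card {i // Quotient.mk S i = q} ≤ B := by
      obtain ⟨i, rfl⟩ := Quotient.exists_rep q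
      exact (Nat.card_congr (Equiv.subtypeEquivRight fun j => Quotient.eq)).trans_le (hB i)
    calc Nat.card ι = ∑ q : Quotient S, Nat.card {i // Quotient.mk S i = q} := by
          rw [← Nat.card_sigma, Nat.card_congr (Equiv.sigmaFiberEquiv (Quotient.mk S))]
      _ ≤ ∑ _q : Quotient S, B := Finset.sum_le_sum fun q _ => hclass q
      _ = B * Nat.card (Quotient S) := by
          rw [Finset.sum_const, Finset.card_univ, Nat.card_eq_fintype_card, smul_eq_mul, mul_comm]
  · refine not_nonempty_iff.1 fun h => hij (E.injective ?_)
    rw [← (E i).out_eq, ← (E j).out_eq]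
    exact Quotient.sound h

section UnitalExtension

variable {p : ℕ} {R U V : Type*} [CommRing R] [AddCommGroup U] [AddCommGroup V] [Module R U]
  [Module R V] [Module (ZMod p) R] [Module (ZMod p) U] [Module (ZMod p) V]

theorem seriesLength_etaFilter_unitalExtension [Nontrivial R] (ι : U →ₗ[R] V)
    (T : U →ₗ[R] V →ₗ[R] V) :
    seriesLength (etaFilter p (HeisenbergGroup (unitalExtension ι T))) = 2 :=
  HeisenbergGroup.seriesLength_etaFilter (exists_unitalExtension_eq ι T)

theorem exists_isLexLeastAdjointRefinement_unitalExtension [Finite R] [Finite U] [Finite V]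
    {ι : U →ₗ[R] V} (hι : Function.Injective ι) (T : U →ₗ[R] V →ₗ[R] V) {x : R}
    (hx : IsNilpotent x) {m : ℕ} (hxm : x ^ m ≠ 0) :
    ∃ α, IsLexLeastAdjointRefinement (etaFilter p (HeisenbergGroup (unitalExtension ι T))) α ∧
      (m + 1 : ℕ∞) ≤ seriesLength α := by
  have : Nontrivial R := ⟨⟨_, _, hxm⟩⟩
  refine ⟨_, isLexLeastAdjointRefinement_one
    (HeisenbergGroup.etaSeries_two_ne_top (exists_unitalExtension_eq ι T)),
    HeisenbergGroup.le_seriesLength_adjointRefinement (exists_unitalExtension_eq ι T)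
      (unitalExtension_nondegenerate hι T) hx (v := ((0, 1), 0)) fun h => hxm ?_⟩
  simpa using congrArg (fun v => v.1.2) h

end UnitalExtension

theorem exists_pairwise_nonisomorphic_unitalExtension {p : ℕ} [Fact p.Prime] {R U V : Type*}
    [CommRing R] [AddCommGroup U] [AddCommGroup V] [Algebra (ZMod p) R] [Module (ZMod p) U]
    [Module (ZMod p) V] [Module.Finite (ZMod p) R] [Module.Finite (ZMod p) U]
    [Module.Finite (ZMod p) V] [Module R U] [Module R V] [Algebra R (ZMod p)]
    [IsScalarTower R (ZMod p) U] [IsScalarTower R (ZMod p) V] (ι : U →ₗ[R] V) {n : ℕ}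
    (hn : Module.finrank (ZMod p) U + 2 * Module.finrank (ZMod p) V +
      3 * Module.finrank (ZMod p) R = n) :
    ∃ (k : ℕ) (T : Fin k → U →ₗ[R] V →ₗ[R] V),
      p ^ (Module.finrank (ZMod p) U * Module.finrank (ZMod p) V ^ 2) ≤ p ^ n ^ 2 * k ∧
      (∀ i, Nat.card (HeisenbergGroup (unitalExtension ι (T i))) = p ^ n) ∧
      ∀ i j, i ≠ j → IsEmpty (HeisenbergGroup (unitalExtension ι (T i)) ≃*
        HeisenbergGroup (unitalExtension ι (T j))) := by
  have hdim : Module.finrank (ZMod p) (U × R) + Module.finrank (ZMod p) (V × R) +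
      Module.finrank (ZMod p) (V × R) = n := by
    rw [Module.finrank_prod, Module.finrank_prod, ← hn]
    ring
  have hcard (T : U →ₗ[R] V →ₗ[R] V) :
      Nat.card (HeisenbergGroup (unitalExtension ι T)) = p ^ n := by
    rw [HeisenbergGroup.natCard_eq_pow_finrank p, hdim]
  have : Finite R := Module.finite_of_finite (ZMod p)
  have : Finite U := Module.finite_of_finite (ZMod p)
  have : Finite V := Module.finite_of_finite (ZMod p)
  have : Finite (U →ₗ[ZMod p] V →ₗ[ZMod p] V) := Module.finite_of_finite (ZMod p)
  let restrict (T : U →ₗ[ZMod p] V →ₗ[ZMod p] V) : U →ₗ[R] V →ₗ[R] V :=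
    LinearMap.restrictScalars₁₂ R R T
  have hrestrict : Function.Injective restrict := fun T T' h =>
    LinearMap.ext₂ fun u v => LinearMap.congr_fun₂ h u v
  have hclass (T : U →ₗ[ZMod p] V →ₗ[ZMod p] V) :
      Nat.card {T' // Nonempty (HeisenbergGroup (unitalExtension ι (restrict T')) ≃*
        HeisenbergGroup (unitalExtension ι (restrict T)))} ≤ p ^ n ^ 2 := by
    refine (HeisenbergGroup.natCard_nonempty_mulEquiv_le p
      ((unitalExtension_injective ι).comp hrestrict) _).trans_eq ?_
    rw [hcard, hdim, ← pow_mul, sq]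
  obtain ⟨k, f, hk, hf⟩ := exists_pairwise_nonisomorphic _ hclass
  refine ⟨k, fun i => restrict (f i), ?_, fun i => hcard _, hf⟩
  rwa [Module.natCard_eq_pow_finrank (K := ZMod p), Nat.card_zmod, Module.finrank_linearMap,
    Module.finrank_linearMap, ← sq] at hk

/-! ### Truncated polynomial rings -/

section TruncatedPolynomial

open Polynomial

variable (F : Type*) [CommRing F] (m : ℕ)

/-- The ring `F[x] / (x ^ (m + 1))`. -/
abbrev TruncatedPolynomial : Type _ := AdjoinRoot (X ^ (m + 1) : F[X])

namespace TruncatedPolynomial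

instance : Module.Finite F (TruncatedPolynomial F m) := (monic_X_pow (m + 1)).finite_adjoinRoot

/-- The evaluation at zero makes `F` an algebra over `F[x] / (x ^ (m + 1))`, so that modules
over `F` become modules over this ring through its quotient `F`. -/
noncomputable instance : Algebra (TruncatedPolynomial F m) F :=
  (AdjoinRoot.lift (RingHom.id F) 0 (by simp)).toAlgebra

theorem finrank_eq [Nontrivial F] : Module.finrank F (TruncatedPolynomial F m) = m + 1 := by
  rw [(AdjoinRoot.powerBasis' (monic_X_pow (m + 1))).finrank, AdjoinRoot.powerBasis'_dim,
    natDegree_X_pow]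

theorem isNilpotent_root : IsNilpotent (AdjoinRoot.root (X ^ (m + 1) : F[X])) :=
  ⟨m + 1, by rw [← AdjoinRoot.mk_X, ← map_pow, AdjoinRoot.mk_self]⟩

theorem root_pow_ne_zero [Nontrivial F] : AdjoinRoot.root (X ^ (m + 1) : F[X]) ^ m ≠ 0 := by
  rw [← AdjoinRoot.mk_X, ← map_pow, Ne, AdjoinRoot.mk_eq_zero, X_pow_dvd_iff]
  exact fun h => one_ne_zero ((coeff_X_pow_self m).symm.trans (h m m.lt_succ_self))

end TruncatedPolynomial

end TruncatedPolynomial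

theorem exists_add_two_mul_eq {n : ℕ} (hn : 4 ≤ n) :
    ∃ r s : ℕ, r + 2 * s = n ∧ r ≤ s ∧ n ≤ 3 * r + 4 :=
  ⟨(n - 2 * (2 * n % 3)) / 3, (n - 2 * (2 * n % 3)) / 3 + 2 * n % 3, by omega, by omega, by omega⟩

theorem cube_div_sub_sq_le_mul_sq {m n r s : ℕ} (hrs : r ≤ s) (hr : n ≤ 3 * r + 3 * m + 7)
    (hn : 3 * m + 7 ≤ n) :
    (n : ℝ) ^ 3 / 27 - (m + 2) * (n : ℝ) ^ 2 + (n : ℝ) ^ 2 ≤ r * (s : ℝ) ^ 2 := by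
  obtain ⟨a, ha⟩ : ∃ a : ℝ, (n : ℝ) = 3 * a := ⟨n / 3, by ring⟩
  obtain ⟨b, hmb⟩ : ∃ b : ℝ, (m : ℝ) = b - 7 / 3 := ⟨m + 7 / 3, by ring⟩
  have hb : 7 / 3 ≤ b := by linarith [m.cast_nonneg (α := ℝ)]
  have hab : b ≤ a := by
    have : (3 * m + 7 : ℝ) ≤ n := by exact_mod_cast hn
    linarith
  have hra : a - b ≤ r := by
    have : (n : ℝ) ≤ 3 * r + 3 * m + 7 := by exact_mod_cast hr
    linarith
  have hrs' : (r : ℝ) ≤ s := by exact_mod_cast hrs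
  calc (n : ℝ) ^ 3 / 27 - (m + 2) * (n : ℝ) ^ 2 + (n : ℝ) ^ 2
      ≤ a ^ 3 - 3 * a ^ 2 * b := by
        rw [ha, hmb]
        nlinarith [mul_nonneg (sub_nonneg.2 hb) (sq_nonneg a)]
    _ ≤ (a - b) ^ 3 := by
        have hb0 : 0 ≤ b := by linarith
        nlinarith [mul_nonneg (sq_nonneg b) (sub_nonneg.2 hab), pow_nonneg hb0 3]
    _ ≤ (r : ℝ) ^ 3 := pow_le_pow_left₀ (sub_nonneg.2 hab) hra 3
    _ = r * (r : ℝ) ^ 2 := pow_succ' _ _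
    _ ≤ r * (s : ℝ) ^ 2 := by gcongr

theorem rpow_le_of_pow_le_pow_mul {p a b k : ℕ} (hp : 1 ≤ p) (h : p ^ a ≤ p ^ b * k) {x : ℝ}
    (hx : x + b ≤ a) : (p : ℝ) ^ x ≤ k := by
  have hp1 : (1 : ℝ) ≤ p := by exact_mod_cast hp
  have hp0 : (0 : ℝ) < p := one_pos.trans_le hp1
  refine le_of_mul_le_mul_left ?_ (pow_pos hp0 b)
  calc (p : ℝ) ^ b * (p : ℝ) ^ x = (p : ℝ) ^ (x + b) := by
        rw [Real.rpow_add hp0, Real.rpow_natCast, mul_comm]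
    _ ≤ (p : ℝ) ^ a := by
        rw [← Real.rpow_natCast]
        exact Real.rpow_le_rpow_of_exponent_le hp1 hx
    _ ≤ (p : ℝ) ^ b * k := by exact_mod_cast h

theorem mainTheorem1_general {p : ℕ} (hp : p.Prime) {m n : ℕ} (hn : 3 * m + 7 ≤ n) :
    ∃ (k : ℕ) (G : Fin k → Type) (_ : ∀ i, Group (G i)),
      (p : ℝ) ^ ((n : ℝ) ^ 3 / 27 - (m + 2) * (n : ℝ) ^ 2) ≤ (k : ℝ) ∧
      (∀ i, Nat.card (G i) = p ^ n ∧
        seriesLength (etaFilter p (G i)) = 2 ∧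
        ∃ α : ℕ × ℕ → Subgroup (G i),
          IsLexLeastAdjointRefinement (etaFilter p (G i)) α ∧
            (m + 1 : ℕ∞) ≤ seriesLength α) ∧
      ∀ i j, i ≠ j → IsEmpty (G i ≃* G j) := by
  have : Fact p.Prime := ⟨hp⟩
  obtain ⟨r, s, hn', hrs, hr⟩ := exists_add_two_mul_eq (n := n - 3 * (m + 1)) (by omega)
  let R := TruncatedPolynomial (ZMod p) m
  have : Finite R := Module.finite_of_finite (ZMod p)
  have hxm := TruncatedPolynomial.root_pow_ne_zero (ZMod p) m
  have : Nontrivial R := ⟨_, _, hxm⟩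
  obtain ⟨ι, hι⟩ : ∃ ι : (Fin r → ZMod p) →ₗ[R] (Fin s → ZMod p), Function.Injective ι := by
    obtain ⟨ι, hι⟩ := (finrank_le_iff_exists_linearMap (R := ZMod p) (M := Fin r → ZMod p)
      (M' := Fin s → ZMod p)).1 (by simpa using hrs)
    exact ⟨ι.restrictScalars R, hι⟩
  obtain ⟨k, T, hk, hcard, hT⟩ := exists_pairwise_nonisomorphic_unitalExtension
    (p := p) (n := n) ι (by
      rw [TruncatedPolynomial.finrank_eq, Module.finrank_fin_fun, Module.finrank_fin_fun]
      omega)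
  rw [Module.finrank_fin_fun, Module.finrank_fin_fun] at hk
  exact ⟨k, fun i => HeisenbergGroup (unitalExtension ι (T i)), fun _ => inferInstance,
    rpow_le_of_pow_le_pow_mul hp.one_le hk
      (by exact_mod_cast cube_div_sub_sq_le_mul_sq hrs (by omega) hn),
    fun i => ⟨hcard i, seriesLength_etaFilter_unitalExtension ι (T i),
      exists_isLexLeastAdjointRefinement_unitalExtension hι (T i)
        (TruncatedPolynomial.isNilpotent_root _ m) hxm⟩, hT⟩

theorem mainTheorem1 :
    ∃ c : ℝ, 0 < c ∧ ∀ p : ℕ, p.Prime → ∃ N : ℕ, ∀ n : ℕ, N ≤ n →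
      ∃ (k : ℕ) (G : Fin k → Type) (_ : ∀ i, Group (G i)),
        (p : ℝ) ^ (2 * (n : ℝ) ^ 3 / 729 + c * (n : ℝ) ^ 2) ≤ (k : ℝ) ∧
        (∀ i, Nat.card (G i) = p ^ n ∧
          seriesLength (etaFilter p (G i)) = 2 ∧
          ∃ α : ℕ × ℕ → Subgroup (G i),
            IsLexLeastAdjointRefinement (etaFilter p (G i)) α ∧ 6 ≤ seriesLength α) ∧
        ∀ i j, i ≠ j → IsEmpty (G i ≃* G j) := by
  refine ⟨1, one_pos, fun p hp => ⟨234, fun n hn => ?_⟩⟩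
  obtain ⟨k, G, hG, hk, hprop, hiso⟩ := mainTheorem1_general hp (m := 5) (n := n) (by omega)
  refine ⟨k, G, hG, le_trans (Real.rpow_le_rpow_of_exponent_le ?_ ?_) hk, ?_, hiso⟩
  · exact_mod_cast hp.one_le
  · -- `n ^ 3 / 27 - 2 * n ^ 3 / 729 = 25 * n ^ 3 / 729` exceeds `8 * n ^ 2` for `n ≥ 234`.
    have hn' : (234 : ℝ) ≤ n := by exact_mod_cast hn
    push_cast
    nlinarith [mul_le_mul_of_nonneg_right hn' (sq_nonneg (n : ℝ))]
  · exact_mod_cast hprop
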